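/- Let $X$ be a compact metric space and $T:X\to X$ a homeomorphism. Suppose that $(X,T)$ is uniquely weakly mixing, that is: there is exactly one ergodic $T$-invariant Borel probability measure $P$ on $X$, and the maximal spectral type of the Koopman operator $U_Tf=f\circ T$ on $L^2(X,P)$ is the equivalence class (under mutual absolute continuity) of $\delta_0+\nu$, where $\delta_0$ is the Dirac measure at the angle $0$ of the circle $\mathbb{R}/2\pi\mathbb{Z}$ and $\nu$ is a continuous (atomless) finite measure on the circle. Here the maximal spectral type is the class of $\sigma_{f_1}$ for a spectral decomposition $L^2(X,P)=\bigoplus_{i\ge 1} C(f_i)$ into mutually orthogonal cyclic spaces $C(f_i)=\overline{\mathrm{span}}\{U_T^nf_i : n\in\mathbb{Z}\}$ with $\sigma_{f_1}\gg\sigma_{f_2}\gg\cdots$, where $\sigma_f$ is the finite positive measure on the circle with $\int e^{-int}\,d\sigma_f(t)=\langle U_T^nf,f\rangle$ for all $n\in\mathbb{Z}$. Let $\mu$ denote the Möbius function. Then for every continuous function $f:X\to\mathbb{C}$ with $\int_X f\,dP=0$ and every point $x\in X$, $$\frac1N\sum_{n=1}^{N} f(T^nx)\,\mu^2(n)\longrightarrow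 0\qquad (N\to\infty).$$ -/

import Mathlib

open MeasureTheory Filter Topology

noncomputable section

namespace SpectralTheory

/-! Spectral measures and the maximal spectral type of a unitary operator `V` of a complex
Hilbert space `H`. -/

section Unitary

variable {H : Type*} [NormedAddCommGroup H] [InnerProductSpace ℂ H]

/-- `σ` is the spectral measure of `f` with respect to the unitary operator `V`: the finite
positive Borel measure on the circle `ℝ / 2πℤ` whose Fourier coefficients are
`∫ e^{-int} dσ(t) = ⟨V ^ n f, f⟩` for all integers `n`.
(Mathlib's inner product is linear in its second argument.) -/
structure IsSpectralMeasure (V : H ≃ₗᵢ[ℂ] H) (f : H)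
    (σ : Measure (AddCircle (2 * Real.pi))) : Prop where
  finite : IsFiniteMeasure σ
  coeff : ∀ n : ℤ, ∫ t, fourier (-n) t ∂σ = inner ℂ f ((V ^ n) f)

/-- The cyclic space `C(f)`: the closed linear span of `V ^ n f`, `n ∈ ℤ`. -/
def cyclicSpace (V : H ≃ₗᵢ[ℂ] H) (f : H) : Submodule ℂ H :=
  (Submodule.span ℂ (Set.range fun n : ℤ => (V ^ n) f)).topologicalClosure

/-- A spectral decomposition of `V`: the whole space is the Hilbert sum of the cyclic spaces
`C(f 0), C(f 1), …`, and the spectral measures satisfy `σ 0 ≫ σ 1 ≫ ⋯`.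
(Some of the `f i` may be zero, so finite decompositions are included.) -/
structure IsSpectralDecomposition (V : H ≃ₗᵢ[ℂ] H) (f : ℕ → H)
    (σ : ℕ → Measure (AddCircle (2 * Real.pi))) : Prop where
  spectral : ∀ i, IsSpectralMeasure V (f i) (σ i)
  orthogonal : ∀ i j, i ≠ j → cyclicSpace V (f i) ⟂ cyclicSpace V (f j)
  total : (⨆ i, cyclicSpace V (f i)).topologicalClosure = ⊤
  decreasing : ∀ i, σ (i + 1) ≪ σ i

/-- The measure `ρ` belongs to the maximal spectral type of `V`, that is, to the equivalence
class (mutual absolute continuity) of the first spectral measure of a spectral decomposition. -/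
def HasMaximalSpectralType (V : H ≃ₗᵢ[ℂ] H) (ρ : Measure (AddCircle (2 * Real.pi))) : Prop :=
  ∃ (f : ℕ → H) (σ : ℕ → Measure (AddCircle (2 * Real.pi))),
    IsSpectralDecomposition V f σ ∧ ρ ≪ σ 0 ∧ σ 0 ≪ ρ

end Unitary

section Dynamics

variable {X : Type*} [TopologicalSpace X] [MeasurableSpace X] [BorelSpace X]

/-- The inverse of a measure preserving homeomorphism is measure preserving. -/
theorem measurePreserving_symm (T : X ≃ₜ X) (P : Measure X) (hT : MeasurePreserving T P P) :
    MeasurePreserving T.symm P P :=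
  MeasurePreserving.symm T.toMeasurableEquiv hT

/-- The Koopman operator `f ↦ f ∘ T` as a unitary operator of `L²(X, P)`. -/
def koopman (T : X ≃ₜ X) (P : Measure X) (hT : MeasurePreserving T P P) :
    Lp ℂ 2 P ≃ₗᵢ[ℂ] Lp ℂ 2 P :=
  LinearIsometryEquiv.ofSurjective (Lp.compMeasurePreservingₗᵢ ℂ T hT) (fun g =>
    ⟨Lp.compMeasurePreserving T.symm (measurePreserving_symm T P hT) g, by
      have h := Lp.compMeasurePreserving_comp_apply (E := ℂ) (p := 2) g
        (measurePreserving_symm T P hT) hT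
      refine h.symm.trans ?_
      have e : (T.symm ∘ T : X → X) = id := by funext x; simp
      simp [e]⟩)

/-- The homeomorphism `T` is uniquely weakly mixing, with measure `P`: `P` is the unique
ergodic `T`-invariant Borel probability measure, and the maximal spectral type of the Koopman
operator on `L²(X, P)` is the class of the sum of the Dirac measure at the angle
zero and a continuous finite measure, that is, one without point masses. -/
structure UniquelyWeaklyMixing (T : X ≃ₜ X) (P : Measure X) : Prop where
  isProbabilityMeasure : IsProbabilityMeasure P
  ergodic : Ergodic T P
  unique : ∀ Q : Measure X, IsProbabilityMeasure Q → Ergodic T Q → Q = P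
  spectralType : ∃ ν : Measure (AddCircle (2 * Real.pi)), IsFiniteMeasure ν ∧ (∀ t, ν {t} = 0) ∧
    HasMaximalSpectralType (koopman T P ergodic.toMeasurePreserving) (Measure.dirac 0 + ν)

end Dynamics

end SpectralTheory

end

namespace SpectralTheory

/-! ### Unique ergodicity -/

section UniqueErgodicity

variable {X : Type*} [MetricSpace X] [CompactSpace X] [MeasurableSpace X] [BorelSpace X]

/-! The square-free indicator `μ²` is, up to upper density `1/D`, the periodic sequence that sieves
out multiples of `d²` for `2 ≤ d ≤ D`. A periodic sequence is a finite combination of characters `z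
^ n`, so it suffices that the averages of `z ^ n * f (T^[n] x)` vanish for every `|z| = 1`; no
cancellation in `μ` is needed.

For `z = 1` this is unique ergodicity and `∫ f = 0`. For `z ≠ 1` the spectral type has no atom at
the angle of `z`, so `z⁻¹` is not an eigenvalue of the Koopman operator `U`
(`HasMaximalSpectralType.eq_zero_of_eigenvector`), and von Neumann's theorem for `z • U` makes the
twisted Birkhoff averages of `f` small in `L¹`. Such an average `F` is continuous, and the twisted
orbit averages of `f` and `F` differ by `o(1)`; that of `F` is bounded by the orbit average of
`|F|`, which tends to `∫ |F|` by unique ergodicity. This yields convergence at every point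
(`tendsto_twisted_average_of_unique_ergodic`). -/

/-- If all ergodic probability measures of a continuous self-map of a compact metric space
coincide with `P`, then so do all invariant probability measures. -/
theorem eq_of_invariant_of_unique_ergodic {T : X → X} (hT : Continuous T) (P : ProbabilityMeasure X)
    (hP : ∀ Q : Measure X, IsProbabilityMeasure Q → Ergodic T Q → Q = P)
    (Q : ProbabilityMeasure X) (hQ : MeasurePreserving T (Q : Measure X) Q) : Q = P := by
  -- Probability measures do not form a vector space; `J` embeds them in a locally convex product,
  -- where Krein–Milman applies to the compact convex image of the invariant ones.
  let J : ProbabilityMeasure X → (BoundedContinuousFunction X ℝ → ℝ) := fun R φ =>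
    ∫ y, φ y ∂(R : Measure X)
  have hJc : Continuous J := continuous_pi fun φ =>
    ProbabilityMeasure.continuous_integral_boundedContinuousFunction φ
  have hJi : Function.Injective J := fun R R' h => Subtype.ext <| by
    change (R : Measure X) = (R' : Measure X)
    exact ext_of_forall_integral_eq_of_IsFiniteMeasure fun φ => congrFun h φ
  let S : Set (ProbabilityMeasure X) := {R | R.map hT.measurable.aemeasurable = R}
  have hS : ∀ R : ProbabilityMeasure X, R ∈ S ↔ MeasurePreserving T (R : Measure X) R := by
    intro R
    constructor
    · intro h
      exact ⟨hT.measurable, congrArg Subtype.val h⟩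
    · intro h
      exact Subtype.ext h.map_eq
  have hScomp : IsCompact S :=
    (isClosed_eq (ProbabilityMeasure.continuous_map hT) continuous_id).isCompact
  have hKcomp : IsCompact (J '' S) := hScomp.image hJc
  have hJcomb : ∀ (R R' R'' : ProbabilityMeasure X) (a b : ENNReal), a ≠ ⊤ → b ≠ ⊤ →
      (R'' : Measure X) = a • (R : Measure X) + b • (R' : Measure X) →
      J R'' = a.toReal • J R + b.toReal • J R' := by
    intro R R' R'' a b ha hb h
    funext φ
    have hi : ∀ R : ProbabilityMeasure X, Integrable φ (R : Measure X) := fun R => φ.integrable _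
    simp only [J, h, Pi.add_apply, Pi.smul_apply]
    rw [integral_add_measure ((hi R).smul_measure ha) ((hi R').smul_measure hb),
      integral_smul_measure, integral_smul_measure]
  have hKconv : Convex ℝ (J '' S) := by
    rintro _ ⟨R, hR, rfl⟩ _ ⟨R', hR', rfl⟩ a b ha hb hab
    have hprob : IsProbabilityMeasure
        (ENNReal.ofReal a • (R : Measure X) + ENNReal.ofReal b • (R' : Measure X)) := by
      constructor
      simp [← ENNReal.ofReal_add ha hb, hab]
    refine ⟨⟨_, hprob⟩, (hS _).2 ?_, ?_⟩
    · exact ⟨hT.measurable, by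
        change Measure.map T (_ + _) = _ + _
        rw [Measure.map_add _ _ hT.measurable, Measure.map_smul, Measure.map_smul,
          ((hS R).1 hR).map_eq, ((hS R').1 hR').map_eq]⟩
    · rw [hJcomb R R' ⟨_, hprob⟩ _ _ ENNReal.ofReal_ne_top ENNReal.ofReal_ne_top rfl,
        ENNReal.toReal_ofReal ha, ENNReal.toReal_ofReal hb]
  have hext : (J '' S).extremePoints ℝ ⊆ {J P} := by
    intro y hy
    obtain ⟨⟨R, hR, rfl⟩, hy⟩ := mem_extremePoints.1 hy
    have herg : Ergodic T (R : Measure X) := by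
      refine Ergodic.of_mem_extremePoints (mem_extremePoints.2 ⟨⟨(hS R).1 hR, R.2⟩, ?_⟩)
      rintro R₁ ⟨h₁, p₁⟩ R₂ ⟨h₂, p₂⟩ ⟨a, b, ha, hb, hab, h⟩
      have ha' : a ≠ ⊤ := by rintro rfl; simp at hab
      have hb' : b ≠ ⊤ := by rintro rfl; simp at hab
      have key := hy _ ⟨⟨R₁, p₁⟩, (hS _).2 h₁, rfl⟩ _ ⟨⟨R₂, p₂⟩, (hS _).2 h₂, rfl⟩
        ⟨a.toReal, b.toReal, ENNReal.toReal_pos ha.ne' ha', ENNReal.toReal_pos hb.ne' hb',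
          by rw [← ENNReal.toReal_add ha' hb', hab, ENNReal.toReal_one],
          (hJcomb ⟨R₁, p₁⟩ ⟨R₂, p₂⟩ R a b ha' hb' h.symm).symm⟩
      exact ⟨congrArg Subtype.val (hJi key.1), congrArg Subtype.val (hJi key.2)⟩
    rw [Subtype.ext (hP R R.2 herg) (a1 := R) (a2 := P)]
    rfl
  have hsub : J '' S ⊆ {J P} := by
    rw [← closure_convexHull_extremePoints hKcomp hKconv]
    exact closure_minimal (convexHull_min hext (convex_singleton _)) isClosed_singleton
  exact hJi (hsub ⟨Q, (hS Q).2 hQ, rfl⟩)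

/-- The empirical measure of the orbit segment `x, T x, …, T ^ N x`. -/
noncomputable def empiricalMeasure (T : X → X) (x : X) (N : ℕ) : ProbabilityMeasure X :=
  ⟨((N : ENNReal) + 1)⁻¹ • ∑ n ∈ Finset.range (N + 1), Measure.dirac (T^[n] x), by
    constructor
    simp only [Measure.smul_apply, Measure.finsetSum_apply, measure_univ, Finset.sum_const,
      Finset.card_range, smul_eq_mul, nsmul_eq_mul, mul_one, Nat.cast_add, Nat.cast_one]
    exact ENNReal.inv_mul_cancel (by simp) (by finiteness)⟩

theorem integral_empiricalMeasure (T : X → X) (x : X) (N : ℕ) {φ : X → ℝ} (hφ : Continuous φ) :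
    ∫ y, φ y ∂(empiricalMeasure T x N : Measure X) =
      ((N : ℝ) + 1)⁻¹ * ∑ n ∈ Finset.range (N + 1), φ (T^[n] x) := by
  change ∫ y, φ y ∂(((N : ENNReal) + 1)⁻¹ • ∑ n ∈ Finset.range (N + 1),
    Measure.dirac (T^[n] x)) = _
  rw [integral_smul_measure, integral_finsetSum_measure]
  · simp [ENNReal.toReal_inv, ENNReal.toReal_add]
  · intro i _
    exact (BoundedContinuousFunction.mkOfCompact ⟨φ, hφ⟩).integrable _

/-- By compactness it is enough to identify cluster points. Each is invariant, because integrating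
`φ ∘ T - φ` against an empirical measure telescopes to two boundary terms over `N + 1`. -/
theorem tendsto_empiricalMeasure {T : X → X} (hT : Continuous T) (P : ProbabilityMeasure X)
    (hP : ∀ Q : Measure X, IsProbabilityMeasure Q → Ergodic T Q → Q = P) (x : X) :
    Tendsto (empiricalMeasure T x) atTop (𝓝 P) := by
  refine le_nhds_of_unique_clusterPt fun Q hQ => ?_
  obtain ⟨U, hU, hUQ⟩ := mapClusterPt_iff_ultrafilter.1 hQ
  refine eq_of_invariant_of_unique_ergodic hT P hP Q ⟨hT.measurable, ?_⟩
  have hmap : IsProbabilityMeasure (Measure.map T (Q : Measure X)) :=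
    Measure.isProbabilityMeasure_map hT.measurable.aemeasurable
  refine ext_of_forall_integral_eq_of_IsFiniteMeasure fun φ => ?_
  rw [integral_map hT.measurable.aemeasurable φ.continuous.aestronglyMeasurable]
  have h₁ := ProbabilityMeasure.tendsto_iff_forall_integral_tendsto.1 hUQ φ
  have h₂ := ProbabilityMeasure.tendsto_iff_forall_integral_tendsto.1 hUQ
    (φ.compContinuous ⟨T, hT⟩)
  have h₃ : Tendsto (fun N => ∫ y, φ (T y) ∂(empiricalMeasure T x N : Measure X) -
      ∫ y, φ y ∂(empiricalMeasure T x N : Measure X)) U (𝓝 0) := by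
    refine Tendsto.mono_left ?_ hU
    have hb : ∀ N : ℕ, ‖∫ y, φ (T y) ∂(empiricalMeasure T x N : Measure X) -
        ∫ y, φ y ∂(empiricalMeasure T x N : Measure X)‖ ≤ 2 * ‖φ‖ * (1 / ((N : ℝ) + 1)) := by
      intro N
      rw [integral_empiricalMeasure T x N (φ := fun y => φ (T y)) (φ.continuous.comp hT),
        integral_empiricalMeasure T x N φ.continuous, ← mul_sub, ← Finset.sum_sub_distrib]
      have : ∀ n, φ (T (T^[n] x)) - φ (T^[n] x) = φ (T^[n + 1] x) - φ (T^[n] x) := fun n => by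
        rw [Function.iterate_succ_apply']
      simp only [this]
      rw [Finset.sum_range_sub (fun n => φ (T^[n] x)), norm_mul, norm_inv,
        Real.norm_of_nonneg (by positivity : (0 : ℝ) ≤ (N : ℝ) + 1), mul_comm, one_div]
      gcongr
      refine (norm_sub_le _ _).trans ?_
      linarith [φ.norm_coe_le_norm (T^[N + 1] x), φ.norm_coe_le_norm (T^[0] x)]
    refine squeeze_zero_norm hb ?_
    simpa using tendsto_one_div_add_atTop_nhds_zero_nat.const_mul (2 * ‖φ‖)
  have h₄ := tendsto_nhds_unique h₃ (h₂.sub h₁)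
  exact (sub_eq_zero.1 h₄.symm)

/-- In a uniquely ergodic system, ergodic averages of continuous functions converge along every
orbit. -/
theorem tendsto_average_of_unique_ergodic {T : X → X} (hT : Continuous T) (P : Measure X)
    [IsProbabilityMeasure P] (hP : ∀ Q : Measure X, IsProbabilityMeasure Q → Ergodic T Q → Q = P)
    (x : X) {φ : X → ℝ} (hφ : Continuous φ) :
    Tendsto (fun N : ℕ => (N : ℝ)⁻¹ * ∑ n ∈ Finset.range N, φ (T^[n] x)) atTop
      (𝓝 (∫ y, φ y ∂P)) := by
  have h := ProbabilityMeasure.tendsto_iff_forall_integral_tendsto.1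
    (tendsto_empiricalMeasure hT ⟨P, inferInstance⟩ hP x)
    (BoundedContinuousFunction.mkOfCompact ⟨φ, hφ⟩)
  refine (tendsto_add_atTop_iff_nat 1).1 (h.congr fun N => ?_)
  simpa using integral_empiricalMeasure T x N hφ

end UniqueErgodicity

/-! ### Eigenvectors and the maximal spectral type -/

section Eigenvectors

theorem tendsto_inv_mul_geom_sum {z : ℂ} (hz : ‖z‖ = 1) (hz1 : z ≠ 1) :
    Tendsto (fun N : ℕ => (N : ℂ)⁻¹ * ∑ n ∈ Finset.range N, z ^ n) atTop (𝓝 0) := by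
  have hb : ∀ N : ℕ, ‖(N : ℂ)⁻¹ * ∑ n ∈ Finset.range N, z ^ n‖ ≤ (N : ℝ)⁻¹ * (2 / ‖z - 1‖) := by
    intro N
    rw [geom_sum_eq hz1, norm_mul, norm_inv, Complex.norm_natCast, norm_div]
    gcongr
    refine (norm_sub_le _ _).trans ?_
    rw [norm_pow, hz, one_pow, norm_one]
    norm_num
  refine squeeze_zero_norm hb ?_
  simpa using tendsto_inv_atTop_nhds_zero_nat.mul_const (2 / ‖z - 1‖)

variable {H : Type*} [NormedAddCommGroup H] [InnerProductSpace ℂ H]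

/-- Powers of `V` are commuting isometries. This carries orthogonality from a generator to its whole
cyclic space. -/
theorem IsSpectralMeasure.zpow_apply {V : H ≃ₗᵢ[ℂ] H} {f : H}
    {σ : Measure (AddCircle (2 * Real.pi))} (hσ : IsSpectralMeasure V f σ) (k : ℤ) :
    IsSpectralMeasure V ((V ^ k) f) σ := by
  refine ⟨hσ.finite, fun n => ?_⟩
  have : (V ^ n) ((V ^ k) f) = (V ^ k) ((V ^ n) f) := by
    change (V ^ n * V ^ k) f = (V ^ k * V ^ n) f
    rw [← zpow_add, ← zpow_add, add_comm]
  rw [hσ.coeff n, this, LinearIsometryEquiv.inner_map_map]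

theorem norm_fourier_apply (n : ℤ) (t : AddCircle (2 * Real.pi)) : ‖fourier n t‖ = 1 := by
  rw [fourier_apply]
  exact Circle.norm_coe _

theorem fourier_neg_natCast_apply (n : ℕ) (t : AddCircle (2 * Real.pi)) :
    fourier (-(n : ℤ)) t = fourier (-1) t ^ n := by
  simp [fourier_apply, AddCircle.toCircle_nsmul, AddCircle.toCircle_neg]

theorem fourier_one_injective :
    Function.Injective (fun t : AddCircle (2 * Real.pi) => fourier 1 t) := by
  intro s t h
  simp only [fourier_apply, one_smul] at h
  exact AddCircle.injective_toCircle Real.two_pi_pos.ne' (Circle.ext h)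

theorem fourier_one_mul_fourier_neg_one (t : AddCircle (2 * Real.pi)) :
    fourier 1 t * fourier (-1) t = 1 := by
  rw [← fourier_add]
  simp

variable [CompleteSpace H]

/-- An eigenvector with eigenvalue `e^{-it}` is orthogonal to every vector whose spectral measure
has no mass at `t`. -/
theorem IsSpectralMeasure.inner_eq_zero_of_eigenvector {V : H ≃ₗᵢ[ℂ] H} {f : H}
    {σ : Measure (AddCircle (2 * Real.pi))} (hσ : IsSpectralMeasure V f σ)
    {t : AddCircle (2 * Real.pi)} (ht : σ {t} = 0) {g : H} (hg : V g = fourier (-1) t • g) :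
    inner ℂ g f = 0 := by
  have := hσ.finite
  -- With `W = z • V`, the eigenvector `g` is a fixed vector. The averages of `W ^ n f` converge to
  -- the projection `p` of `f` on the fixed space, while their inner products with `f` are integrals
  -- of geometric averages that tend to `0` off `t`, hence `σ`-almost everywhere.
  set z : ℂ := fourier 1 t with hz
  have hz1 : ‖z‖ = 1 := norm_fourier_apply 1 t
  have hu : ∀ s, ‖z * fourier (-1) s‖ = 1 := fun s => by
    rw [norm_mul, hz1, norm_fourier_apply, one_mul]
  let W : H →L[ℂ] H := z • (V.toContinuousLinearEquiv : H →L[ℂ] H)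
  have hWapp : ∀ v, W v = z • V v := fun v => rfl
  have hWnorm : ‖W‖ ≤ 1 := ContinuousLinearMap.opNorm_le_bound _ zero_le_one fun v => by
    rw [hWapp, norm_smul, hz1, LinearIsometryEquiv.norm_map]
  have hWpow : ∀ n : ℕ, W^[n] f = z ^ n • (V ^ (n : ℤ)) f := by
    intro n
    induction n with
    | zero => simp
    | succ n ih =>
      rw [Function.iterate_succ_apply', ih, hWapp, map_smul, smul_smul, ← pow_succ', zpow_natCast,
        zpow_natCast, pow_succ' V, LinearIsometryEquiv.coe_mul, Function.comp_apply]
  set p := (W.eqLocus (1 : H →L[ℂ] H)).orthogonalProjectionOnto f with hp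
  have hlim := W.tendsto_birkhoffAverage_orthogonalProjection hWnorm f
  have hlim' : Tendsto (fun N => inner ℂ f (birkhoffAverage ℂ W _root_.id N f)) atTop
      (𝓝 (inner ℂ f (p : H))) := tendsto_const_nhds.inner hlim
  have hint : ∀ N : ℕ, inner ℂ f (birkhoffAverage ℂ W _root_.id N f) =
      ∫ s, (N : ℂ)⁻¹ * ∑ n ∈ Finset.range N, (z * fourier (-1) s) ^ n ∂σ := by
    intro N
    rw [birkhoffAverage, birkhoffSum, inner_smul_right, inner_sum, integral_const_mul,
      integral_finsetSum]
    · congr 1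
      refine Finset.sum_congr rfl fun n _ => ?_
      rw [_root_.id, hWpow, inner_smul_right, ← hσ.coeff, ← integral_const_mul]
      refine integral_congr_ae (Eventually.of_forall fun s => ?_)
      simp only [mul_pow, fourier_neg_natCast_apply]
    · intro n _
      refine Integrable.of_bound (C := 1) ?_ (Eventually.of_forall fun s => ?_)
      · exact Continuous.aestronglyMeasurable (by fun_prop)
      · simp only [norm_pow, hu, one_pow, le_refl]
  have hzero : Tendsto (fun N => inner ℂ f (birkhoffAverage ℂ W _root_.id N f)) atTop (𝓝 0) := by
    simp only [hint]
    rw [← integral_zero (AddCircle (2 * Real.pi)) ℂ (μ := σ)]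
    refine tendsto_integral_filter_of_dominated_convergence (fun _ => 1)
      (Eventually.of_forall fun N => ?_) (Eventually.of_forall fun N => Eventually.of_forall
      fun s => ?_) (integrable_const _) ?_
    · exact Continuous.aestronglyMeasurable (by fun_prop)
    · have : ‖∑ n ∈ Finset.range N, (z * fourier (-1) s) ^ n‖ ≤ N := by
        refine (norm_sum_le _ _).trans ?_
        simp only [norm_pow, hu, one_pow, Finset.sum_const, Finset.card_range, nsmul_eq_mul,
          mul_one, le_refl]
      rw [norm_mul, norm_inv, Complex.norm_natCast]
      refine (mul_le_mul_of_nonneg_left this (by positivity)).trans ?_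
      exact inv_mul_le_one
    · have hae : ∀ᵐ s ∂σ, s ≠ t := by
        rw [ae_iff]
        simpa using ht
      filter_upwards [hae] with s hs
      refine tendsto_inv_mul_geom_sum (hu s) fun h => hs ?_
      apply fourier_one_injective
      have h2 := fourier_one_mul_fourier_neg_one s
      have h3 : fourier (-1) s ≠ (0 : ℂ) := fun h0 => by simp [h0] at h2
      exact mul_right_cancel₀ h3 (h2.trans h.symm)
  have hfp : inner ℂ f (p : H) = 0 := tendsto_nhds_unique hlim' hzero
  -- `⟨p, p⟩ = ⟨p, f⟩ = 0`.
  have hp0 : p = 0 := by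
    have := Submodule.inner_orthogonalProjectionOnto_eq_of_mem_left p f
    rw [← hp, ← inner_conj_symm (p : H), hfp, map_zero] at this
    exact inner_self_eq_zero.1 this
  have hgmem : g ∈ W.eqLocus (1 : H →L[ℂ] H) := by
    change W g = g
    rw [hWapp, hg, smul_smul, fourier_one_mul_fourier_neg_one, one_smul]
  have := Submodule.inner_orthogonalProjectionOnto_eq_of_mem_left (⟨g, hgmem⟩ :
    W.eqLocus (1 : H →L[ℂ] H)) f
  rw [← hp, hp0, inner_zero_right] at this
  exact this.symm

/-- If the maximal spectral type has no mass at `t`, then `e^{-it}` is not an eigenvalue. -/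
theorem HasMaximalSpectralType.eq_zero_of_eigenvector {V : H ≃ₗᵢ[ℂ] H}
    {ρ : Measure (AddCircle (2 * Real.pi))} (hρ : HasMaximalSpectralType V ρ)
    {t : AddCircle (2 * Real.pi)} (ht : ρ {t} = 0) {g : H} (hg : V g = fourier (-1) t • g) :
    g = 0 := by
  obtain ⟨f, σ, hdec, -, h0⟩ := hρ
  have hac : ∀ i, σ i ≪ ρ := fun i => by
    induction i with
    | zero => exact h0
    | succ i ih => exact (hdec.decreasing i).trans ih
  have hcyc : ∀ i, cyclicSpace V (f i) ≤ (ℂ ∙ g)ᗮ := by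
    intro i
    refine Submodule.topologicalClosure_minimal _ (Submodule.span_le.2 ?_)
      (Submodule.isClosed_orthogonal _)
    rintro _ ⟨n, rfl⟩
    exact (Submodule.mem_orthogonal_singleton_iff_inner_right).2
      (((hdec.spectral i).zpow_apply n).inner_eq_zero_of_eigenvector (hac i ht) hg)
  have htop : (⊤ : Submodule ℂ H) ≤ (ℂ ∙ g)ᗮ := by
    rw [← hdec.total]
    exact Submodule.topologicalClosure_minimal _ (iSup_le hcyc) (Submodule.isClosed_orthogonal _)
  exact inner_self_eq_zero.1
    (Submodule.mem_orthogonal_singleton_iff_inner_right.1 (htop (Submodule.mem_top (x := g))))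

end Eigenvectors

/-! ### Averages twisted by a character -/

section TwistedAverages

theorem exists_fourier_one_eq {z : ℂ} (hz : ‖z‖ = 1) :
    ∃ t : AddCircle (2 * Real.pi), fourier 1 t = z := by
  obtain ⟨t, ht⟩ := (AddCircle.homeomorphCircle Real.two_pi_pos.ne').surjective
    ⟨z, mem_sphere_zero_iff_norm.2 hz⟩
  rw [AddCircle.homeomorphCircle_apply] at ht
  exact ⟨t, by rw [fourier_apply, one_smul, ht]⟩

section Topological

variable {X : Type*} [TopologicalSpace X]

/-- The operator `g ↦ z • g ∘ T` on continuous functions. -/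
noncomputable def twistedComp (T : X ≃ₜ X) (z : ℂ) (g : C(X, ℂ)) : C(X, ℂ) := z • g.comp (T : C(X, X))

@[simp]
theorem twistedComp_apply (T : X ≃ₜ X) (z : ℂ) (g : C(X, ℂ)) (x : X) :
    twistedComp T z g x = z * g (T x) := rfl

end Topological

variable {X : Type*} [MetricSpace X] [CompactSpace X] [MeasurableSpace X] [BorelSpace X]

/-- Links the `L²` mean ergodic theorem to averages that remain continuous functions and so can be
evaluated along an orbit. -/
theorem toLp_twistedComp (T : X ≃ₜ X) (P : Measure X) [IsFiniteMeasure P]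
    (hT : MeasurePreserving T P P) (z : ℂ) (g : C(X, ℂ)) :
    ContinuousMap.toLp 2 P ℂ (twistedComp T z g) =
      z • koopman T P hT (ContinuousMap.toLp 2 P ℂ g) := by
  rw [twistedComp, map_smul]
  refine congrArg (z • ·) ?_
  apply Lp.ext
  have h₁ := ContinuousMap.coeFn_toLp (p := 2) (𝕜 := ℂ) P (g.comp (T : C(X, X)))
  have h₂ := Lp.coeFn_compMeasurePreserving (ContinuousMap.toLp 2 P ℂ g) hT
  have h₃ := hT.quasiMeasurePreserving.ae_eq_comp (ContinuousMap.coeFn_toLp (p := 2) (𝕜 := ℂ) P g)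
  exact h₁.trans (h₂.trans h₃).symm

/-- If `z⁻¹` is not an eigenvalue of the Koopman operator, then the twisted averages of a continuous
function tend to zero in `L¹`. -/
theorem tendsto_integral_norm_twisted_birkhoffAverage (T : X ≃ₜ X) (P : Measure X)
    [IsProbabilityMeasure P] (hT : MeasurePreserving T P P) {z : ℂ} (hz : ‖z‖ = 1)
    (hev : ∀ g : Lp ℂ 2 P, z • koopman T P hT g = g → g = 0) (f : C(X, ℂ)) :
    Tendsto (fun N => ∫ x, ‖birkhoffAverage ℂ (twistedComp T z) id N f x‖ ∂P) atTop (𝓝 0) := by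
  let W : Lp ℂ 2 P →L[ℂ] Lp ℂ 2 P :=
    z • ((koopman T P hT).toContinuousLinearEquiv : Lp ℂ 2 P →L[ℂ] Lp ℂ 2 P)
  have hWapp : ∀ v, W v = z • koopman T P hT v := fun v => rfl
  have hWnorm : ‖W‖ ≤ 1 := ContinuousLinearMap.opNorm_le_bound _ zero_le_one fun v => by
    rw [hWapp, norm_smul, hz, LinearIsometryEquiv.norm_map]
  have hlim := W.tendsto_birkhoffAverage_orthogonalProjection hWnorm (ContinuousMap.toLp 2 P ℂ f)
  have hproj : ((W.eqLocus (1 : Lp ℂ 2 P →L[ℂ] Lp ℂ 2 P)).orthogonalProjectionOnto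
      (ContinuousMap.toLp 2 P ℂ f) : Lp ℂ 2 P) = 0 := by
    apply hev
    exact ((W.eqLocus (1 : Lp ℂ 2 P →L[ℂ] Lp ℂ 2 P)).orthogonalProjectionOnto
      (ContinuousMap.toLp 2 P ℂ f)).2
  rw [hproj] at hlim
  have hsemi : ∀ n, ContinuousMap.toLp 2 P ℂ ((twistedComp T z)^[n] f) =
      W^[n] (ContinuousMap.toLp 2 P ℂ f) := by
    intro n
    induction n with
    | zero => rfl
    | succ n ih =>
      rw [Function.iterate_succ_apply', Function.iterate_succ_apply', toLp_twistedComp T P hT, ih]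
      rfl
  have havg : ∀ N, birkhoffAverage ℂ W _root_.id N (ContinuousMap.toLp 2 P ℂ f) =
      ContinuousMap.toLp 2 P ℂ (birkhoffAverage ℂ (twistedComp T z) id N f) := by
    intro N
    simp [birkhoffAverage, birkhoffSum, hsemi]
  have hle : ∀ F : C(X, ℂ), ∫ x, ‖F x‖ ∂P ≤ ‖ContinuousMap.toLp 2 P ℂ F‖ := by
    intro F
    have hm : AEStronglyMeasurable F P := F.continuous.aestronglyMeasurable
    have hae := ContinuousMap.coeFn_toLp (p := 2) (𝕜 := ℂ) P F
    rw [integral_norm_eq_lintegral_enorm hm, ← eLpNorm_one_eq_lintegral_enorm, Lp.norm_def,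
      eLpNorm_congr_ae hae]
    refine ENNReal.toReal_mono ?_ (eLpNorm_le_eLpNorm_of_exponent_le (by norm_num) hm)
    rw [← eLpNorm_congr_ae hae]
    exact Lp.eLpNorm_ne_top _
  refine squeeze_zero (fun N => integral_nonneg fun x => norm_nonneg _) (fun N => ?_)
    (tendsto_zero_iff_norm_tendsto_zero.1 hlim)
  rw [havg]
  exact hle _

/-- In a uniquely ergodic system, if `z⁻¹` is not an eigenvalue of the Koopman operator, then the
averages of a continuous function along an orbit, twisted by `z ^ n`, tend to zero. -/
theorem tendsto_twisted_average_of_unique_ergodic (T : X ≃ₜ X) (P : Measure X)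
    [IsProbabilityMeasure P] (hP : ∀ Q : Measure X, IsProbabilityMeasure Q → Ergodic T Q → Q = P)
    (hT : MeasurePreserving T P P) {z : ℂ} (hz : ‖z‖ = 1)
    (hev : ∀ g : Lp ℂ 2 P, z • koopman T P hT g = g → g = 0) (f : C(X, ℂ)) (x : X) :
    Tendsto (fun N : ℕ => (N : ℂ)⁻¹ * ∑ n ∈ Finset.range N, z ^ n * f (T^[n] x)) atTop (𝓝 0) := by
  let A : ℕ → C(X, ℂ) → ℂ := fun N g => (N : ℂ)⁻¹ * ∑ n ∈ Finset.range N, z ^ n * g (T^[n] x)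
  -- Applying `twistedComp` shifts the twisted sum by one index, so only two boundary terms survive.
  have hshift : ∀ g, Tendsto (fun N => A N (twistedComp T z g) - A N g) atTop (𝓝 0) := by
    intro g
    have hb : ∀ N : ℕ, ‖A N (twistedComp T z g) - A N g‖ ≤ (N : ℝ)⁻¹ * (2 * ‖g‖) := by
      intro N
      have hterm : ∀ n, z ^ n * twistedComp T z g (T^[n] x) - z ^ n * g (T^[n] x) =
          z ^ (n + 1) * g (T^[n + 1] x) - z ^ n * g (T^[n] x) := fun n => by
        rw [twistedComp_apply, Function.iterate_succ_apply', pow_succ, mul_assoc]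
      simp only [A]
      rw [← mul_sub, ← Finset.sum_sub_distrib]
      simp only [hterm]
      rw [Finset.sum_range_sub (fun n => z ^ n * g (T^[n] x)), norm_mul, norm_inv,
        Complex.norm_natCast]
      gcongr
      refine (norm_sub_le _ _).trans ?_
      simp only [norm_mul, norm_pow, hz, one_pow, one_mul]
      linarith [g.norm_coe_le_norm (T^[N] x), g.norm_coe_le_norm (T^[0] x)]
    refine squeeze_zero_norm hb ?_
    simpa using tendsto_inv_atTop_nhds_zero_nat.mul_const (2 * ‖g‖)
  have hiter : ∀ h, Tendsto (fun N => A N ((twistedComp T z)^[h] f) - A N f) atTop (𝓝 0) := by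
    intro h
    induction h with
    | zero => simp
    | succ h ih =>
      rw [Function.iterate_succ_apply']
      simpa using (hshift ((twistedComp T z)^[h] f)).add ih
  have havg : ∀ M : ℕ, M ≠ 0 → Tendsto
      (fun N => A N f - A N (birkhoffAverage ℂ (twistedComp T z) id M f)) atTop (𝓝 0) := by
    intro M hM
    have h := ((tendsto_finsetSum (Finset.range M) fun h _ => hiter h).const_mul (M : ℂ)⁻¹).neg
    simp only [Finset.sum_const_zero, mul_zero, neg_zero] at h
    refine h.congr fun N => ?_
    have hA : A N (birkhoffAverage ℂ (twistedComp T z) id M f) =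
        (M : ℂ)⁻¹ * ∑ h ∈ Finset.range M, A N ((twistedComp T z)^[h] f) := by
      simp only [A, birkhoffAverage, birkhoffSum, id, ContinuousMap.smul_apply,
        ContinuousMap.sum_apply, smul_eq_mul, Finset.mul_sum]
      rw [Finset.sum_comm]
      refine Finset.sum_congr rfl fun _ _ => Finset.sum_congr rfl fun _ _ => ?_
      ring
    rw [hA, Finset.sum_sub_distrib, Finset.sum_const, Finset.card_range, nsmul_eq_mul, mul_sub,
      inv_mul_cancel_left₀ (Nat.cast_ne_zero.2 hM)]
    ring
  rw [Metric.tendsto_atTop']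
  intro ε hε
  obtain ⟨M, hM, hMε⟩ := ((eventually_gt_atTop 0).and
    ((tendsto_integral_norm_twisted_birkhoffAverage T P hT hz hev f).eventually_lt_const
      (half_pos hε))).exists
  set F := birkhoffAverage ℂ (twistedComp T z) id M f
  have h₁ := (tendsto_average_of_unique_ergodic T.continuous P hP x
    F.continuous.norm).eventually_lt_const hMε
  have h₂ := (tendsto_zero_iff_norm_tendsto_zero.1 (havg M hM.ne')).eventually_lt_const
    (half_pos hε)
  obtain ⟨N₀, hN₀⟩ := eventually_atTop.1 (h₁.and h₂)
  refine ⟨N₀, fun N hN => ?_⟩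
  obtain ⟨h₁, h₂⟩ := hN₀ N hN.le
  -- Taking norms removes the twist, since `|z| = 1`.
  have h₃ : ‖A N F‖ ≤ (N : ℝ)⁻¹ * ∑ n ∈ Finset.range N, ‖F (T^[n] x)‖ := by
    simp only [A]
    rw [norm_mul, norm_inv, Complex.norm_natCast]
    gcongr
    refine (norm_sum_le _ _).trans (le_of_eq ?_)
    simp [hz]
  rw [dist_zero_right]
  calc ‖A N f‖ = ‖(A N f - A N F) + A N F‖ := by rw [sub_add_cancel]
    _ ≤ ‖A N f - A N F‖ + ‖A N F‖ := norm_add_le _ _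
    _ < ε := by linarith

/-- In a uniquely weakly mixing system, continuous functions of mean zero have vanishing averages
twisted by any `z ^ n` with `|z| = 1`. -/
theorem UniquelyWeaklyMixing.tendsto_twisted_average {T : X ≃ₜ X} {P : Measure X}
    (hT : UniquelyWeaklyMixing T P) {f : C(X, ℂ)} (hf : ∫ x, f x ∂P = 0) (x : X) {z : ℂ}
    (hz : ‖z‖ = 1) :
    Tendsto (fun N : ℕ => (N : ℂ)⁻¹ * ∑ n ∈ Finset.range N, z ^ n * f (T^[n] x)) atTop (𝓝 0) := by
  have := hT.isProbabilityMeasure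
  obtain ⟨ν, -, hν, htype⟩ := hT.spectralType
  -- The Dirac mass at `0` leaves the eigenvalue `1`, so this case rests on the zero mean instead.
  by_cases hz1 : z = 1
  · subst hz1
    have hint : Integrable f P := f.continuous.integrable_of_hasCompactSupport
      (HasCompactSupport.of_compactSpace _)
    have hre := tendsto_average_of_unique_ergodic T.continuous P hT.unique x
      (Complex.continuous_re.comp f.continuous)
    have him := tendsto_average_of_unique_ergodic T.continuous P hT.unique x
      (Complex.continuous_im.comp f.continuous)
    have hre0 : ∫ y, (Complex.re ∘ f) y ∂P = 0 := by
      rw [show ∫ y, (Complex.re ∘ f) y ∂P = (∫ y, f y ∂P).re from integral_re hint, hf]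
      rfl
    have him0 : ∫ y, (Complex.im ∘ f) y ∂P = 0 := by
      rw [show ∫ y, (Complex.im ∘ f) y ∂P = (∫ y, f y ∂P).im from integral_im hint, hf]
      rfl
    rw [hre0] at hre
    rw [him0] at him
    have h := ((Complex.continuous_ofReal.tendsto 0).comp hre).add
      (((Complex.continuous_ofReal.tendsto 0).comp him).mul_const Complex.I)
    simp only [Complex.ofReal_zero, zero_mul, add_zero] at h
    refine h.congr fun N => ?_
    simp only [Function.comp_apply, Complex.ofReal_mul, Complex.ofReal_inv, Complex.ofReal_natCast,
      Complex.ofReal_sum, one_pow, one_mul]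
    rw [mul_assoc, ← mul_add, Finset.sum_mul, ← Finset.sum_add_distrib]
    simp only [Complex.re_add_im]
  · refine tendsto_twisted_average_of_unique_ergodic T P hT.unique hT.ergodic.toMeasurePreserving
      hz (fun g hg => ?_) f x
    obtain ⟨t, htz⟩ := exists_fourier_one_eq hz
    refine htype.eq_zero_of_eigenvector (t := t) ?_ ?_
    · have ht0 : (0 : AddCircle (2 * Real.pi)) ∉ ({t} : Set _) := by
        rintro rfl
        apply hz1
        rw [← htz]
        simp
      simp [hν, Measure.dirac_apply' _ (measurableSet_singleton t), ht0]
    · have h1 : fourier (-1) t * z = 1 := by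
        rw [← htz, mul_comm, fourier_one_mul_fourier_neg_one]
      conv_rhs => rw [← hg, smul_smul, h1, one_smul]

end TwistedAverages

/-! ### Averages over square-free integers -/

section Squarefree

/-- A sequence whose averages twisted by roots of unity vanish is orthogonal to all periodic
sequences. -/
theorem tendsto_average_mul_of_periodic {a : ℕ → ℂ}
    (ha : ∀ z : ℂ, ‖z‖ = 1 →
      Tendsto (fun N : ℕ => (N : ℂ)⁻¹ * ∑ n ∈ Finset.range N, z ^ n * a n) atTop (𝓝 0))
    {Q : ℕ} [NeZero Q] (c : ZMod Q → ℂ) :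
    Tendsto (fun N : ℕ => (N : ℂ)⁻¹ * ∑ n ∈ Finset.range N, c n * a n) atTop (𝓝 0) := by
  -- Fourier inversion on `ZMod Q`.
  have hc : ∀ n : ℕ, c n = ∑ j, ((Q : ℂ)⁻¹ * ZMod.dft c j) * ZMod.stdAddChar j ^ n := by
    intro n
    have h := ZMod.invDFT_apply (ZMod.dft c) (n : ZMod Q)
    rw [LinearEquiv.symm_apply_apply] at h
    rw [h, smul_eq_mul, Finset.mul_sum]
    refine Finset.sum_congr rfl fun j _ => ?_
    rw [← AddChar.map_nsmul_eq_pow, nsmul_eq_mul, mul_comm (n : ZMod Q), smul_eq_mul]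
    ring
  have h := tendsto_finsetSum (Finset.univ : Finset (ZMod Q)) fun j _ =>
    (ha (ZMod.stdAddChar j) (AddChar.norm_apply _ j)).const_mul ((Q : ℂ)⁻¹ * ZMod.dft c j)
  simp only [mul_zero, Finset.sum_const_zero] at h
  refine h.congr fun N => ?_
  simp only [hc, Finset.sum_mul, Finset.mul_sum]
  rw [Finset.sum_comm]
  refine Finset.sum_congr rfl fun _ _ => Finset.sum_congr rfl fun _ _ => ?_
  ring

/-- The number of `n < N` that are divisible by the square of some `d > D` is at most `N / D`. -/
theorem card_filter_exists_sq_dvd_le {D : ℕ} (hD : D ≠ 0) (N : ℕ)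
    [DecidablePred fun n => ∃ d, D < d ∧ d ^ 2 ∣ n] :
    (((Finset.Ioc 0 N).filter fun n => ∃ d, D < d ∧ d ^ 2 ∣ n).card : ℝ) ≤ N * (D : ℝ)⁻¹ := by
  -- `d ≤ d² ≤ n ≤ N` bounds `d`; the `max` only ensures `D` is a valid lower end for the tail
  -- estimate `∑ 1/d² ≤ 1/D`.
  have hsub : ((Finset.Ioc 0 N).filter fun n => ∃ d, D < d ∧ d ^ 2 ∣ n) ⊆
      (Finset.Ioc D (max D N)).biUnion fun d => (Finset.Ioc 0 N).filter fun n => d ^ 2 ∣ n := by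
    intro n hn
    simp only [Finset.mem_filter, Finset.mem_Ioc] at hn
    obtain ⟨⟨hn0, hnN⟩, d, hd, hdn⟩ := hn
    simp only [Finset.mem_biUnion, Finset.mem_filter, Finset.mem_Ioc]
    refine ⟨d, ⟨hd, le_max_of_le_right ?_⟩, ⟨hn0, hnN⟩, hdn⟩
    exact ((Nat.le_self_pow two_ne_zero d).trans (Nat.le_of_dvd hn0 hdn)).trans hnN
  have hcard := (Finset.card_le_card hsub).trans Finset.card_biUnion_le
  have hterm : ∀ d ∈ Finset.Ioc D (max D N),
      (((Finset.Ioc 0 N).filter fun n => d ^ 2 ∣ n).card : ℝ) ≤ N * ((d : ℝ) ^ 2)⁻¹ := by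
    intro d _
    rw [Nat.Ioc_filter_dvd_card_eq_div, ← div_eq_mul_inv]
    exact_mod_cast Nat.cast_div_le (α := ℝ) (m := N) (n := d ^ 2)
  calc (((Finset.Ioc 0 N).filter fun n => ∃ d, D < d ∧ d ^ 2 ∣ n).card : ℝ)
      ≤ ∑ d ∈ Finset.Ioc D (max D N), (((Finset.Ioc 0 N).filter fun n => d ^ 2 ∣ n).card : ℝ) := by
        exact_mod_cast hcard
    _ ≤ ∑ d ∈ Finset.Ioc D (max D N), N * ((d : ℝ) ^ 2)⁻¹ := Finset.sum_le_sum hterm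
    _ = N * ∑ d ∈ Finset.Ioc D (max D N), ((d : ℝ) ^ 2)⁻¹ := by rw [Finset.mul_sum]
    _ ≤ N * (D : ℝ)⁻¹ := by
        gcongr
        refine (sum_Ioc_inv_sq_le_sub hD (le_max_left D N)).trans ?_
        simp only [sub_le_self_iff, inv_nonneg, Nat.cast_nonneg]

open Classical in
/-- The indicator function of the residue classes modulo `D!²` of integers that are not divisible
by `d²` for any `2 ≤ d ≤ D`. -/
noncomputable def squareSieve (D : ℕ) (r : ZMod (D.factorial ^ 2)) : ℂ :=
  if ∃ d, 2 ≤ d ∧ d ≤ D ∧ d ^ 2 ∣ r.val then 0 else 1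

/-- The two indicators differ only if `n` passes the sieve without being square-free; then some
prime `p > D` has `p² ∣ n`. -/
theorem norm_moebius_sq_sub_squareSieve_le (D n : ℕ) [Decidable (∃ d, D < d ∧ d ^ 2 ∣ n)] :
    ‖(ArithmeticFunction.moebius n : ℂ) ^ 2 - squareSieve D n‖ ≤
      if ∃ d, D < d ∧ d ^ 2 ∣ n then 1 else 0 := by
  classical
  have hμ : (ArithmeticFunction.moebius n : ℂ) ^ 2 = if Squarefree n then 1 else 0 := by
    have := ArithmeticFunction.moebius_sq (n := n)
    split_ifs at this ⊢ <;> exact_mod_cast this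
  have hdvd : ∀ d, 2 ≤ d → d ≤ D →
      (d ^ 2 ∣ (n : ZMod (D.factorial ^ 2)).val ↔ d ^ 2 ∣ n) := by
    intro d h2 hd
    rw [ZMod.val_natCast]
    exact Nat.dvd_mod_iff (pow_dvd_pow_of_dvd (Nat.dvd_factorial (by omega) hd) 2)
  have hsieve : squareSieve D n = if ∃ d, 2 ≤ d ∧ d ≤ D ∧ d ^ 2 ∣ n then 0 else 1 := by
    rw [squareSieve]
    refine if_congr (exists_congr fun d => ?_) rfl rfl
    constructor
    · rintro ⟨h2, hd, h⟩
      exact ⟨h2, hd, (hdvd d h2 hd).1 h⟩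
    · rintro ⟨h2, hd, h⟩
      exact ⟨h2, hd, (hdvd d h2 hd).2 h⟩
  rw [hμ, hsieve]
  by_cases hs : ∃ d, 2 ≤ d ∧ d ≤ D ∧ d ^ 2 ∣ n
  · have hsq : ¬ Squarefree n := by
      obtain ⟨d, h2, -, hd⟩ := hs
      intro h
      have := Nat.isUnit_iff.1 (h d (by rwa [← sq]))
      omega
    rw [if_neg hsq, if_pos hs]
    split_ifs <;> simp
  · rw [if_neg hs]
    by_cases hsq : Squarefree n
    · rw [if_pos hsq]
      split_ifs <;> simp
    · have hex : ∃ d, D < d ∧ d ^ 2 ∣ n := by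
        rw [Nat.squarefree_iff_prime_squarefree] at hsq
        push Not at hsq
        obtain ⟨p, hp, hpn⟩ := hsq
        refine ⟨p, ?_, by rwa [sq]⟩
        by_contra hpD
        exact hs ⟨p, hp.two_le, not_lt.1 hpD, by rwa [sq]⟩
      rw [if_neg hsq, if_pos hex]
      simp

/-- A bounded sequence whose averages twisted by roots of unity vanish has vanishing averages over
square-free integers. -/
theorem tendsto_average_mul_moebius_sq {a : ℕ → ℂ} {C : ℝ} (hC : ∀ n, ‖a n‖ ≤ C)
    (ha : ∀ z : ℂ, ‖z‖ = 1 →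
      Tendsto (fun N : ℕ => (N : ℂ)⁻¹ * ∑ n ∈ Finset.range N, z ^ n * a n) atTop (𝓝 0)) :
    Tendsto (fun N : ℕ => (1 / (N : ℂ)) *
      ∑ n ∈ Finset.Icc 1 N, a n * (ArithmeticFunction.moebius n : ℂ) ^ 2) atTop (𝓝 0) := by
  classical
  have hC0 : 0 ≤ C := (norm_nonneg _).trans (hC 0)
  -- Passing from `0, …, N - 1` to `1, …, N` costs two bounded terms, negligible after division by
  -- `N`.
  have hsum : ∀ (b : ℕ → ℂ) (N : ℕ),
      ∑ n ∈ Finset.Ioc 0 N, b n = ∑ n ∈ Finset.range N, b n + b N - b 0 := by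
    intro b N
    induction N with
    | zero => simp
    | succ N ih =>
      rw [Finset.sum_Ioc_succ_top (Nat.zero_le N), ih, Finset.sum_range_succ]
      ring
  have hper : ∀ D : ℕ, Tendsto (fun N : ℕ => (N : ℂ)⁻¹ *
      ∑ n ∈ Finset.Ioc 0 N, squareSieve D n * a n) atTop (𝓝 0) := by
    intro D
    have : NeZero (D.factorial ^ 2) := ⟨pow_ne_zero _ D.factorial_ne_zero⟩
    have hb : ∀ n : ℕ, ‖squareSieve D n * a n‖ ≤ C := by
      intro n
      rw [norm_mul]
      refine (mul_le_of_le_one_left (norm_nonneg _) ?_).trans (hC n)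
      rw [squareSieve]
      split_ifs <;> simp
    have hend : Tendsto (fun N : ℕ => (N : ℂ)⁻¹ *
        (squareSieve D N * a N - squareSieve D (0 : ℕ) * a 0)) atTop (𝓝 0) := by
      refine squeeze_zero_norm (a := fun N : ℕ => (N : ℝ)⁻¹ * (C + C)) (fun N => ?_) ?_
      · rw [norm_mul, norm_inv, Complex.norm_natCast]
        gcongr
        exact (norm_sub_le _ _).trans (add_le_add (hb N) (hb 0))
      · simpa using tendsto_inv_atTop_nhds_zero_nat.mul_const (C + C)
    have h := (tendsto_average_mul_of_periodic ha (squareSieve D)).add hend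
    rw [add_zero] at h
    refine h.congr fun N => ?_
    rw [hsum (fun n : ℕ => squareSieve D n * a n), add_sub_assoc, mul_add]
  rw [Metric.tendsto_atTop']
  intro ε hε
  -- The sieve level is fixed first, with `C / D < ε / 2` uniformly in `N`.
  obtain ⟨D, hD0, hD⟩ := ((eventually_gt_atTop 0).and
    ((tendsto_inv_atTop_nhds_zero_nat.const_mul C).eventually_lt_const
      (by simpa using half_pos hε : C * 0 < ε / 2))).exists
  obtain ⟨N₀, hN₀⟩ := eventually_atTop.1 ((tendsto_zero_iff_norm_tendsto_zero.1
    (hper D)).eventually_lt_const (half_pos hε))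
  refine ⟨N₀, fun N hN => ?_⟩
  have h₁ := hN₀ N hN.le
  have hIcc : Finset.Icc 1 N = Finset.Ioc 0 N := by
    ext n
    simp [Nat.succ_le_iff]
  have h₂ : ‖(N : ℂ)⁻¹ * ∑ n ∈ Finset.Ioc 0 N,
      ((ArithmeticFunction.moebius n : ℂ) ^ 2 - squareSieve D n) * a n‖ ≤ C * (D : ℝ)⁻¹ := by
    rw [norm_mul, norm_inv, Complex.norm_natCast]
    have : ‖∑ n ∈ Finset.Ioc 0 N,
        ((ArithmeticFunction.moebius n : ℂ) ^ 2 - squareSieve D n) * a n‖ ≤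
        N * (D : ℝ)⁻¹ * C := by
      calc _ ≤ ∑ n ∈ Finset.Ioc 0 N, (if ∃ d, D < d ∧ d ^ 2 ∣ n then (1 : ℝ) else 0) * C := by
            refine norm_sum_le_of_le _ fun n _ => ?_
            rw [norm_mul]
            have := norm_moebius_sq_sub_squareSieve_le D n
            gcongr
            exact hC n
        _ = (((Finset.Ioc 0 N).filter fun n => ∃ d, D < d ∧ d ^ 2 ∣ n).card : ℝ) * C := by
            rw [← Finset.sum_mul, Finset.sum_boole]
        _ ≤ _ := by
            gcongr
            exact card_filter_exists_sq_dvd_le hD0.ne' N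
    calc (N : ℝ)⁻¹ * _ ≤ (N : ℝ)⁻¹ * (N * (D : ℝ)⁻¹ * C) := by gcongr
      _ = ((N : ℝ)⁻¹ * N) * (C * (D : ℝ)⁻¹) := by ring
      _ ≤ C * (D : ℝ)⁻¹ := mul_le_of_le_one_left (by positivity) inv_mul_le_one
  rw [dist_zero_right, hIcc, one_div]
  have hsplit : (N : ℂ)⁻¹ * ∑ n ∈ Finset.Ioc 0 N, a n * (ArithmeticFunction.moebius n : ℂ) ^ 2 =
      (N : ℂ)⁻¹ * ∑ n ∈ Finset.Ioc 0 N,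
        ((ArithmeticFunction.moebius n : ℂ) ^ 2 - squareSieve D n) * a n +
      (N : ℂ)⁻¹ * ∑ n ∈ Finset.Ioc 0 N, squareSieve D n * a n := by
    rw [← mul_add, ← Finset.sum_add_distrib]
    congr 1
    refine Finset.sum_congr rfl fun n _ => ?_
    ring
  rw [hsplit]
  refine (norm_add_le _ _).trans_lt ?_
  linarith

end Squarefree

end SpectralTheory

theorem theorem3 {X : Type*} [MetricSpace X] [CompactSpace X] [MeasurableSpace X] [BorelSpace X]
    (T : X ≃ₜ X) (P : Measure X) (hT : SpectralTheory.UniquelyWeaklyMixing T P)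
    (f : C(X, ℂ)) (hf : ∫ x, f x ∂P = 0) (x : X) :
    Tendsto (fun N : ℕ => (1 / (N : ℂ)) *
        ∑ n ∈ Finset.Icc 1 N, f (T^[n] x) * (ArithmeticFunction.moebius n : ℂ) ^ 2)
      atTop (𝓝 0) :=
  SpectralTheory.tendsto_average_mul_moebius_sq (fun n => f.norm_coe_le_norm (T^[n] x))
    fun _ hz => hT.tendsto_twisted_average hf x hz
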